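/- Consider an RIS-aided multiuser downlink in which a base station (BS) with $M$ antennas serves $K$ single-antenna users through a reconfigurable intelligent surface (RIS) with $N$ elements, in the presence of an eavesdropper with $M_{\rm E}$ antennas, where $M>K+M_{\rm E}$. Let $\beta_1,\beta_{2,k},\beta_3>0$ be the path losses of the links BS–RIS, BS–user $k$ and BS–eavesdropper, let $\beta_{{\rm I},k},\beta_{\rm I,E}\ge 0$ be those of the links RIS–user $k$ and RIS–eavesdropper, let $\sigma_k^2>0$ be the noise power at user $k$, $P>0$ the total transmit power and $\xi\in[0,1)$ the fraction of it that is allocated to the information signal (the rest is artificial noise). Let $\mathbf R_{{\rm B},k},\mathbf R_{\rm B,E}\in\mathbb C^{M\times M}$ and $\mathbf R_{{\rm I},k},\mathbf R_{\rm I,E}\in\mathbb C^{N\times N}$ be the correlation matrices at the BS and at the RIS (positive semidefinite with unit diagonal), let $\mathbf H_1\in\mathbb C^{M\times N}$ be the line-of-sight BS–RIS channel with entries $[\mathbf H_1]_{m,n}=\sqrt{\beta_1}\,e^{-j2\pi d_{m,n}/\lambda}$, where $\lambda>0$ is the wavelength and $d_{m,n}\ge 0$ are the distances between BS antennas and RIS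 elements, and let $\mathbf\Phi={\rm diag}(e^{j\theta_1},\dots,e^{j\theta_N})$, $\theta_n\in[0,2\pi)$, be the phase shift matrix of the RIS. Put $$\mathbf R_k=\beta_{2,k}\mathbf R_{{\rm B},k}+\beta_{{\rm I},k}\mathbf H_1\mathbf\Phi\mathbf R_{{\rm I},k}\mathbf\Phi^H\mathbf H_1^H,\qquad \mathbf R_{\rm E}=\beta_{\rm I,E}\mathbf H_1\mathbf\Phi\mathbf R_{\rm I,E}\mathbf\Phi^H\mathbf H_1^H .$$ The closed-form ergodic secrecy rate of user $k$ is $$R_{\rm sec}=\Big[\log_2\Big(1+\frac{S_k}{I_k}\Big)-\log_2\Big(1+\frac{S_{\rm E}}{I_{\rm E}}\Big)\Big]^+,\qquad [x]^+=\max\{0,x\},$$ with $S_k=\xi P[{\rm tr}(\mathbf R_k)]^2$, $I_k=\xi P\sum_{i\ne k}{\rm tr}(\mathbf R_k\mathbf R_i)+\sigma_k^2\sum_{j=1}^K{\rm tr}(\mathbf R_j)$, $S_{\rm E}=\xi MM_{\rm E}(M-K)\,{\rm tr}(\mathbf R_k(\mathbf R_{\rm E}+\beta_3\mathbf R_{\rm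 B,E}))$ and $I_{\rm E}=(1-\xi)(M-K-M_{\rm E})\,{\rm tr}(\mathbf R_{\rm E}+\beta_3\mathbf R_{\rm B,E})\sum_{j=1}^K{\rm tr}(\mathbf R_j)$. Then, without the RIS, i.e. if $\beta_{{\rm I},j}=0$ for all users $j$ and $\beta_{\rm I,E}=0$, this rate reduces for every user $k$ to the following expression, which involves only the correlation matrices at the BS: $$R_{\rm sec}=\bigg[\log_2\bigg(1+\frac{\xi\beta_{2,k}^2PM^2/\sum_{j=1}^K\beta_{2,j}}{\xi P\delta\sum_{i\ne k}\beta_{2,i}{\rm tr}(\mathbf R_{{\rm B},k}\mathbf R_{{\rm B},i})+M\sigma_k^2}\bigg)-\log_2\bigg(1+\frac{\xi M_{\rm E}(M-K)\,\beta_{2,k}\,{\rm tr}(\mathbf R_{{\rm B},k}\mathbf R_{\rm B,E})}{(1-\xi)M(M-K-M_{\rm E})\sum_{j=1}^K\beta_{2,j}}\bigg)\bigg]^+,$$ where $\delta=\beta_{2,k}/\sum_{j=1}^K\beta_{2,j}$. If moreover there is no spatial correlation at the BS, i.e. $\mathbf R_{{\rm B},j}=\mathbf R_{\rm B,E}=\mathbf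 I_M$ for all $j$, this becomes the secrecy rate of the uncorrelated system without RIS, $$R_{\rm sec}=\bigg[\log_2\bigg(1+\frac{\xi\beta_{2,k}^2PM/\sum_{j=1}^K\beta_{2,j}}{\xi P\delta\sum_{i\ne k}\beta_{2,i}+\sigma_k^2}\bigg)-\log_2\bigg(1+\frac{\xi M_{\rm E}(M-K)\,\beta_{2,k}}{(1-\xi)(M-K-M_{\rm E})\sum_{j=1}^K\beta_{2,j}}\bigg)\bigg]^+ .$$ -/

import Mathlib

open scoped Matrix ComplexOrder

noncomputable section

/-- A spatial correlation matrix: positive semidefinite (hence Hermitian) with unit diagonal. -/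
structure IsCorrelationMatrix {n : ℕ} (R : Matrix (Fin n) (Fin n) ℂ) : Prop where
  posSemidef : R.PosSemidef
  diag_one : ∀ i, R i i = 1

/-- The statistical parameters of an RIS-aided multiuser downlink with `M` BS antennas,
`N` reflecting elements, `K` single-antenna users and one eavesdropper with `ME` antennas. -/
structure RISSystem (M N K ME : ℕ) where
  /-- path loss of the link from the BS to the RIS -/
  β₁ : ℝ
  /-- path losses of the links from the BS to the users -/
  β₂ : Fin K → ℝ
  /-- path loss of the link from the BS to the eavesdropper -/
  β₃ : ℝ
  /-- path losses of the links from the RIS to the users (zero if there is no RIS) -/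
  βI : Fin K → ℝ
  /-- path loss of the link from the RIS to the eavesdropper (zero if there is no RIS) -/
  βIE : ℝ
  /-- carrier wavelength -/
  wavelength : ℝ
  /-- distance between BS antenna `m` and reflecting element `n` -/
  dist : Fin M → Fin N → ℝ
  /-- phase shifts of the reflecting elements -/
  θ : Fin N → ℝ
  /-- correlation matrices at the BS, for the users -/
  RB : Fin K → Matrix (Fin M) (Fin M) ℂ
  /-- correlation matrix at the BS, for the eavesdropper -/
  RBE : Matrix (Fin M) (Fin M) ℂ
  /-- correlation matrices at the RIS, for the users -/
  RI : Fin K → Matrix (Fin N) (Fin N) ℂ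
  /-- correlation matrix at the RIS, for the eavesdropper -/
  RIE : Matrix (Fin N) (Fin N) ℂ
  /-- standard deviations of the noise at the users -/
  σ : Fin K → ℝ
  β₁_pos : 0 < β₁
  β₂_pos : ∀ k, 0 < β₂ k
  β₃_pos : 0 < β₃
  βI_nonneg : ∀ k, 0 ≤ βI k
  βIE_nonneg : 0 ≤ βIE
  wavelength_pos : 0 < wavelength
  dist_nonneg : ∀ m n, 0 ≤ dist m n
  θ_mem : ∀ n, θ n ∈ Set.Ico 0 (2 * Real.pi)
  RB_corr : ∀ k, IsCorrelationMatrix (RB k)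
  RBE_corr : IsCorrelationMatrix RBE
  RI_corr : ∀ k, IsCorrelationMatrix (RI k)
  RIE_corr : IsCorrelationMatrix RIE
  σ_pos : ∀ k, 0 < σ k

namespace RISSystem

variable {M N K ME : ℕ} (S : RISSystem M N K ME)

/-- The line-of-sight channel from the BS to the RIS. -/
def H₁ : Matrix (Fin M) (Fin N) ℂ :=
  Matrix.of fun m n =>
    (Real.sqrt S.β₁ : ℂ) *
      Complex.exp (-(Complex.I * 2 * (Real.pi : ℂ) * ((S.dist m n / S.wavelength : ℝ) : ℂ)))

/-- The diagonal phase shift matrix of the RIS. -/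
def Φ : Matrix (Fin N) (Fin N) ℂ :=
  Matrix.diagonal fun n => Complex.exp (Complex.I * (S.θ n : ℂ))

/-- The covariance matrix of the equivalent channel from the BS to user `k`. -/
def R (k : Fin K) : Matrix (Fin M) (Fin M) ℂ :=
  (S.β₂ k : ℂ) • S.RB k + (S.βI k : ℂ) • (S.H₁ * S.Φ * S.RI k * S.Φᴴ * S.H₁ᴴ)

/-- The covariance matrix of the channel from the BS to the eavesdropper through the RIS. -/
def RE : Matrix (Fin M) (Fin M) ℂ :=
  (S.βIE : ℂ) • (S.H₁ * S.Φ * S.RIE * S.Φᴴ * S.H₁ᴴ)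

/-- The covariance matrix of the whole channel from the BS to the eavesdropper. -/
def RETotal : Matrix (Fin M) (Fin M) ℂ :=
  S.RE + (S.β₃ : ℂ) • S.RBE

/-- The real trace. All matrices to which it is applied below are Hermitian or products of two
Hermitian matrices, so their trace is real and nothing is lost. -/
def _root_.retr {n : ℕ} (A : Matrix (Fin n) (Fin n) ℂ) : ℝ := A.trace.re

/-- Signal term of user `k`, for power fraction `ξ` and total power `P`. -/
def signalUser (ξ P : ℝ) (k : Fin K) : ℝ :=
  ξ * P * retr (S.R k) ^ 2

/-- Interference and noise term of user `k`. -/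
def interfUser (ξ P : ℝ) (k : Fin K) : ℝ :=
  ξ * P * (∑ i ∈ Finset.univ.erase k, retr (S.R k * S.R i)) + S.σ k ^ 2 * ∑ j, retr (S.R j)

/-- Signal term of the eavesdropper listening to user `k`. -/
def signalEve (ξ : ℝ) (k : Fin K) : ℝ :=
  ξ * M * ME * ((M : ℝ) - K) * retr (S.R k * S.RETotal)

/-- Artificial-noise term of the eavesdropper. -/
def interfEve (ξ : ℝ) : ℝ :=
  (1 - ξ) * ((M : ℝ) - K - ME) * retr S.RETotal * ∑ j, retr (S.R j)

/-- The closed-form ergodic secrecy rate of user `k`. -/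
def secrecyRate (ξ P : ℝ) (k : Fin K) : ℝ :=
  max 0 (Real.logb 2 (1 + S.signalUser ξ P k / S.interfUser ξ P k) -
    Real.logb 2 (1 + S.signalEve ξ k / S.interfEve ξ))

end RISSystem

end

/-! Without the RIS every covariance matrix is a path loss times a correlation matrix at the BS. The
real trace is real-linear and a unit diagonal makes it equal to `M`, so each term of the rate is
explicit and each quotient differs from its target only by a common factor: the sum of the `β₂ j`
for the user, `M * β₃` for the eavesdropper (`signalUser_div_interfUser`,
`signalEve_div_interfEve`). Uncorrelated antennas allow one more factor `M` to cancel in both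
quotients. -/

theorem retr_smul {n : ℕ} (a : ℝ) (A : Matrix (Fin n) (Fin n) ℂ) :
    retr ((a : ℂ) • A) = a * retr A := by
  simp [retr, Matrix.trace_smul]

theorem retr_one {n : ℕ} : retr (1 : Matrix (Fin n) (Fin n) ℂ) = n := by
  simp [retr]

theorem IsCorrelationMatrix.retr_eq {n : ℕ} {A : Matrix (Fin n) (Fin n) ℂ}
    (hA : IsCorrelationMatrix A) : retr A = n := by
  simp [retr, Matrix.trace, hA.diag_one]

namespace RISSystem

variable {M N K ME : ℕ} (S : RISSystem M N K ME)

theorem R_of_βI_eq_zero {k : Fin K} (h : S.βI k = 0) : S.R k = (S.β₂ k : ℂ) • S.RB k := by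
  simp [R, h]

theorem RETotal_of_βIE_eq_zero (h : S.βIE = 0) : S.RETotal = (S.β₃ : ℂ) • S.RBE := by
  simp [RETotal, RE, h]

theorem retr_R (hI : ∀ j, S.βI j = 0) (k : Fin K) : retr (S.R k) = S.β₂ k * M := by
  rw [S.R_of_βI_eq_zero (hI k), retr_smul, (S.RB_corr k).retr_eq]

theorem retr_R_mul_R (hI : ∀ j, S.βI j = 0) (k i : Fin K) :
    retr (S.R k * S.R i) = S.β₂ k * (S.β₂ i * retr (S.RB k * S.RB i)) := by
  rw [S.R_of_βI_eq_zero (hI k), S.R_of_βI_eq_zero (hI i), Matrix.smul_mul, Matrix.mul_smul,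
    retr_smul, retr_smul]

theorem retr_RETotal (hIE : S.βIE = 0) : retr S.RETotal = S.β₃ * M := by
  rw [S.RETotal_of_βIE_eq_zero hIE, retr_smul, S.RBE_corr.retr_eq]

theorem retr_R_mul_RETotal (hI : ∀ j, S.βI j = 0) (hIE : S.βIE = 0) (k : Fin K) :
    retr (S.R k * S.RETotal) = S.β₂ k * (S.β₃ * retr (S.RB k * S.RBE)) := by
  rw [S.R_of_βI_eq_zero (hI k), S.RETotal_of_βIE_eq_zero hIE, Matrix.smul_mul, Matrix.mul_smul,
    retr_smul, retr_smul]

theorem sum_β₂_pos (k : Fin K) : 0 < ∑ j, S.β₂ j :=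
  Finset.sum_pos (fun j _ => S.β₂_pos j) ⟨k, Finset.mem_univ k⟩

theorem signalUser_div_interfUser (hI : ∀ j, S.βI j = 0) (ξ P : ℝ) (k : Fin K) :
    S.signalUser ξ P k / S.interfUser ξ P k =
      (ξ * S.β₂ k ^ 2 * P * (M : ℝ) ^ 2 / ∑ j, S.β₂ j) /
        (ξ * P * (S.β₂ k / ∑ j, S.β₂ j) *
            (∑ i ∈ Finset.univ.erase k, S.β₂ i * retr (S.RB k * S.RB i)) +
          M * S.σ k ^ 2) := by
  have hB := (S.sum_β₂_pos k).ne'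
  simp only [signalUser, interfUser, S.retr_R hI, S.retr_R_mul_R hI, ← Finset.mul_sum,
    ← Finset.sum_mul]
  rw [← div_div_div_cancel_right₀ hB]
  congr 1
  · ring
  · field_simp

/-- The direct path loss `β₃` scales the signal and the artificial noise alike, so it drops out. The
two traces in the noise term give `M` twice; the explicit `M` of the signal term cancels only one of
them. -/
theorem signalEve_div_interfEve (hM : 0 < M) (hI : ∀ j, S.βI j = 0) (hIE : S.βIE = 0) (ξ : ℝ)
    (k : Fin K) :
    S.signalEve ξ k / S.interfEve ξ =
      ξ * ME * ((M : ℝ) - K) * S.β₂ k * retr (S.RB k * S.RBE) /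
        ((1 - ξ) * M * ((M : ℝ) - K - ME) * ∑ j, S.β₂ j) := by
  have hc : (M : ℝ) * S.β₃ ≠ 0 := mul_ne_zero (Nat.cast_ne_zero.mpr hM.ne') S.β₃_pos.ne'
  simp only [signalEve, interfEve, S.retr_R hI, S.retr_R_mul_RETotal hI hIE, S.retr_RETotal hIE,
    ← Finset.sum_mul]
  -- Expanding the target by `M * β₃` requires only that factor to be nonzero, not the denominators.
  rw [← mul_div_mul_right _ ((1 - ξ) * M * ((M : ℝ) - K - ME) * ∑ j, S.β₂ j) hc]
  congr 1 <;> ring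

end RISSystem

theorem corollary3 {M N K ME : ℕ} (hM : K + ME < M) (S : RISSystem M N K ME)
    (ξ P : ℝ) (hξ₀ : 0 ≤ ξ) (hξ₁ : ξ < 1) (hP : 0 < P)
    (hI : ∀ j, S.βI j = 0) (hIE : S.βIE = 0) (k : Fin K) :
    S.secrecyRate ξ P k =
      max 0
        (Real.logb 2 (1 + (ξ * S.β₂ k ^ 2 * P * (M : ℝ) ^ 2 / ∑ j, S.β₂ j) /
            (ξ * P * (S.β₂ k / ∑ j, S.β₂ j) *
                (∑ i ∈ Finset.univ.erase k, S.β₂ i * retr (S.RB k * S.RB i)) +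
              M * S.σ k ^ 2)) -
          Real.logb 2 (1 + ξ * ME * ((M : ℝ) - K) * S.β₂ k * retr (S.RB k * S.RBE) /
            ((1 - ξ) * M * ((M : ℝ) - K - ME) * ∑ j, S.β₂ j))) ∧
    ((∀ j, S.RB j = 1) → S.RBE = 1 →
      S.secrecyRate ξ P k =
        max 0
          (Real.logb 2 (1 + (ξ * S.β₂ k ^ 2 * P * M / ∑ j, S.β₂ j) /
              (ξ * P * (S.β₂ k / ∑ j, S.β₂ j) * (∑ i ∈ Finset.univ.erase k, S.β₂ i) +
                S.σ k ^ 2)) -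
            Real.logb 2 (1 + ξ * ME * ((M : ℝ) - K) * S.β₂ k /
              ((1 - ξ) * ((M : ℝ) - K - ME) * ∑ j, S.β₂ j)))) := by
  have hM₀ : 0 < M := by omega
  have hM' : (M : ℝ) ≠ 0 := Nat.cast_ne_zero.mpr hM₀.ne'
  rw [RISSystem.secrecyRate, S.signalUser_div_interfUser hI,
    S.signalEve_div_interfEve hM₀ hI hIE]
  refine ⟨rfl, fun hRB hRBE => ?_⟩
  simp only [hRB, hRBE, mul_one, retr_one, ← Finset.sum_mul]
  -- Peels off `max`, the difference, `logb` and `1 +`, leaving one equality of quotients for the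
  -- user and one for the eavesdropper.
  congr 4
  -- The explicit denominator selects the right-hand quotient, whose noise term lacks the factor
  -- `M`, as the one to expand.
  · rw [← mul_div_mul_right _ (_ + S.σ k ^ 2) hM']
    congr 1 <;> ring
  · rw [← mul_div_mul_right _ ((1 - ξ) * ((M : ℝ) - K - ME) * _) hM']
    congr 1
    ring
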